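/- Let $1\le m\le N$ and $d$ be integers and $\tau=m/N$. A dataset of size $n$ is an unordered collection (multiset) of $n$ elements of a set $X$; two datasets of the same size are adjacent if one is obtained from the other by replacing one element. For $P\ll Q$ and $\alpha>1$ put $D_\alpha(P\|Q)=\frac1{\alpha-1}\log\int (dP/dQ)^\alpha\,dQ$ (and $D_\alpha(P\|Q)=\infty$ otherwise). A randomized mechanism $\mathcal M$ is $(\alpha,\rho)$-RDP if $D_\alpha(\mathcal M(D)\|\mathcal M(D'))\le\rho$ for all adjacent datasets $D,D'$. Let $f$ map datasets of size $m$ to $\mathbb R^d$ with $\ell_2$-sensitivity $\sup_{S,S'\text{ adjacent}}\|f(S)-f(S')\|_2$ at most $1$. Consider the mechanism that, given a dataset $D$ of size $N$, draws a subset $S$ of $m=\tau N$ of its entries uniformly without replacement and outputs $f(S)+\mathcal N(0,\nu^2 I_d)$. If $\alpha>1$ is real, $\nu^2\ge \frac23$ and $$\alpha-1\le \frac23\,\nu^2\ln\frac{1}{\alpha\tau(1+\nu^2)},$$ then this mechanism satisfies $\bigl(\alpha,\,3.5\,\tau^2\alpha/\nu^2\bigr)$-RDP. -/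

import Mathlib

open MeasureTheory ProbabilityTheory
open scoped ENNReal

noncomputable section

namespace SubsampledRDP

/-- A dataset of `n` elements of `X`: an unordered collection, repetitions allowed. -/
abbrev Dataset (X : Type*) (n : ℕ) : Type _ := Sym X n

/-- The replace-one relation: `D'` is obtained from `D` by replacing one element `a` by `b`. -/
def Adjacent {X : Type*} {n : ℕ} (D D' : Dataset X n) : Prop :=
  ∃ (C : Multiset X) (a b : X), (D : Multiset X) = a ::ₘ C ∧ (D' : Multiset X) = b ::ₘ C

/-- The `ℓ²`-sensitivity of `f`: the supremum of `‖f D - f D'‖₂` over all adjacent `D`, `D'`. -/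
def l2Sensitivity {X : Type*} {n d : ℕ} (f : Dataset X n → EuclideanSpace ℝ (Fin d)) : ℝ≥0∞ :=
  ⨆ (D : Dataset X n) (D' : Dataset X n) (_ : Adjacent D D'), edist (f D) (f D')

/-- The Rényi divergence of order `α > 1`,
`D_α(P ‖ Q) = (α - 1)⁻¹ log ∫ (dP/dQ)^α dQ`, with value `∞` if `P` is not absolutely continuous
with respect to `Q`. -/
def renyiDiv {E : Type*} [MeasurableSpace E] (α : ℝ) (P Q : Measure E) : EReal :=
  open Classical in
  if P ≪ Q then (((α - 1)⁻¹ : ℝ) : EReal) * ENNReal.log (∫⁻ x, (P.rnDeriv Q x) ^ α ∂Q) else ⊤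

/-- A randomized mechanism, given by the law of its output on each dataset of size `n`, satisfies
`(α, ρ)`-Rényi differential privacy (for `α > 1`). -/
def IsRDP {X : Type*} {n d : ℕ} (α ρ : ℝ)
    (M : Dataset X n → Measure (EuclideanSpace ℝ (Fin d))) : Prop :=
  ∀ D D' : Dataset X n, Adjacent D D' → renyiDiv α (M D) (M D') ≤ (ρ : EReal)

/-- The Gaussian mechanism `f(D) + N(0, ν² I)`. -/
def gaussianMechanism {X : Type*} {n d : ℕ} (f : Dataset X n → EuclideanSpace ℝ (Fin d)) (ν : ℝ)
    (D : Dataset X n) : Measure (EuclideanSpace ℝ (Fin d)) :=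
  multivariateGaussian (f D) (ν ^ 2 • (1 : Matrix (Fin d) (Fin d) ℝ))

/-- The `n.choose m` subcollections of size `m` of a dataset of size `n`, each listed once for
every choice of `m` of the `n` entries. -/
def subsets {X : Type*} {n : ℕ} (m : ℕ) (D : Dataset X n) : Multiset (Dataset X m) :=
  (Multiset.powersetCard m (D : Multiset X)).pmap (fun s hs => Sym.mk s hs)
    (fun _ hs => (Multiset.mem_powersetCard.mp hs).2)

/-- `M` applied to a subset of size `m` drawn uniformly without replacement from a dataset of size
`n ≥ m`: the output law is the average of the laws `M s` over the `n.choose m` subsets `s`. -/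
def uniformSubsampled {X : Type*} {m d : ℕ} (n : ℕ)
    (M : Dataset X m → Measure (EuclideanSpace ℝ (Fin d))) (D : Dataset X n) :
    Measure (EuclideanSpace ℝ (Fin d)) :=
  ((n.choose m : ℝ≥0∞))⁻¹ • ((subsets m D).map M).sum

end SubsampledRDP

end

namespace SubsampledRDP

open scoped RealInnerProductSpace

/-! Write the adjacent datasets as `a ::ₘ C` and `b ::ₘ C`. Drawing a uniform pair of a subset `T ⊆
C` of size `m - 1` and a further entry `c` of `C`, the subsample is `c ::ₘ T` with probability `1 -
τ`, and otherwise `a ::ₘ T` or `b ::ₘ T` (`exists_coupling`). Since `(p, q) ↦ p ^ α q ^ (1 - α)` is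
jointly convex, it suffices to treat one pair (`renyiDiv_average_le`): the mixtures `(1 - τ) g + τ
a` and `q = (1 - τ) g + τ b` of Gaussian densities whose three centres are pairwise at distance at
most 1.

With `x = τ (a - b) / q` the integrand is `q (1 + x) ^ α`. Its linear term integrates to zero, and a
`PowerBound` controls the rest by `x²`, `x₊³` and `x₊ ^ α`. Convexity of negative powers replaces
the mixture `q` in the denominators by `g` and `b` (`mixture_rpow_le`), leaving explicit Gaussian
integrals. With `s = 1 / ν²`, the quadratic one is at most `3.2 s`; the assumption on `τ` makes the
higher terms small multiples of `s` (`exists_powerBound`). Hence the `α`-moment is at most `1 + 3.5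
τ² α (α - 1) s`, and `1 + y ≤ exp y` finishes. -/

/-- The isotropic Gaussian `N(u, ν² I)`. -/
noncomputable abbrev isoGaussian {d : ℕ} (ν : ℝ) (u : EuclideanSpace ℝ (Fin d)) :
    Measure (EuclideanSpace ℝ (Fin d)) :=
  multivariateGaussian u (ν ^ 2 • (1 : Matrix (Fin d) (Fin d) ℝ))

/-! ### Exponential moments of isotropic Gaussians -/

lemma charFun_isoGaussian {d : ℕ} (ν : ℝ) (u t : EuclideanSpace ℝ (Fin d)) :
    charFun (isoGaussian ν u) t =
      Complex.exp (⟪t, u⟫ * Complex.I - (ν ^ 2 * ‖t‖ ^ 2 : ℝ) / 2) := by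
  have hS : (ν ^ 2 • (1 : Matrix (Fin d) (Fin d) ℝ)).PosSemidef :=
    Matrix.PosSemidef.one.smul (sq_nonneg ν)
  rw [charFun_multivariateGaussian hS]
  congr 3
  rw [EuclideanSpace.real_norm_sq_eq, Matrix.smul_mulVec, Matrix.one_mulVec, dotProduct_smul]
  simp [dotProduct, sq]

lemma isoGaussian_map_inner {d : ℕ} (ν : ℝ) (u v : EuclideanSpace ℝ (Fin d)) :
    (isoGaussian ν u).map (fun x ↦ ⟪v, x⟫) =
      gaussianReal ⟪v, u⟫ (ν ^ 2 * ‖v‖ ^ 2).toNNReal := by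
  have h : Measurable fun x : EuclideanSpace ℝ (Fin d) ↦ ⟪v, x⟫ := by fun_prop
  have := Measure.isProbabilityMeasure_map (μ := isoGaussian ν u) h.aemeasurable
  apply Measure.ext_of_charFun
  ext t
  have h1 : charFun ((isoGaussian ν u).map (fun x ↦ ⟪v, x⟫)) t
      = charFun (isoGaussian ν u) (t • v) := by
    rw [charFun_apply, charFun_apply, integral_map h.aemeasurable (by fun_prop)]
    congr 1 with x
    simp [inner_smul_right, real_inner_comm, mul_comm]
  rw [h1, charFun_isoGaussian, charFun_gaussianReal, inner_smul_left, norm_smul,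
    Real.coe_toNNReal _ (by positivity)]
  congr 1
  simp only [mul_pow, Real.norm_eq_abs, sq_abs]
  push_cast
  simp
  ring

lemma integrable_exp_inner {d : ℕ} (ν : ℝ) (u v : EuclideanSpace ℝ (Fin d)) :
    Integrable (fun x ↦ Real.exp ⟪v, x⟫) (isoGaussian ν u) := by
  have h : Measurable fun x : EuclideanSpace ℝ (Fin d) ↦ ⟪v, x⟫ := by fun_prop
  have := integrable_exp_mul_gaussianReal (μ := ⟪v, u⟫) (v := (ν ^ 2 * ‖v‖ ^ 2).toNNReal) 1
  rw [← isoGaussian_map_inner, integrable_map_measure (by fun_prop) h.aemeasurable] at this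
  simpa [Function.comp_def] using this

lemma integral_exp_inner {d : ℕ} (ν : ℝ) (u v : EuclideanSpace ℝ (Fin d)) :
    ∫ x, Real.exp ⟪v, x⟫ ∂(isoGaussian ν u) = Real.exp (⟪v, u⟫ + ν ^ 2 * ‖v‖ ^ 2 / 2) := by
  have := mgf_gaussianReal (isoGaussian_map_inner ν u v) 1
  rw [Real.coe_toNNReal _ (by positivity)] at this
  simpa [mgf] using this

/-! ### Gaussian densities and integrals of products of their powers -/

/-- The density of `N(u, ν² I)` with respect to `N(0, ν² I)`. -/
noncomputable def gaussianDensity {d : ℕ} (ν : ℝ) (u x : EuclideanSpace ℝ (Fin d)) : ℝ :=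
  Real.exp (⟪u, x⟫ / ν ^ 2 - ‖u‖ ^ 2 / (2 * ν ^ 2))

lemma gaussianDensity_pos {d : ℕ} (ν : ℝ) (u x : EuclideanSpace ℝ (Fin d)) :
    0 < gaussianDensity ν u x := Real.exp_pos _

@[fun_prop]
lemma measurable_gaussianDensity {d : ℕ} (ν : ℝ) (u : EuclideanSpace ℝ (Fin d)) :
    Measurable (gaussianDensity ν u) := by
  unfold gaussianDensity; fun_prop

section Moments

variable {d : ℕ} {ν : ℝ} (u₀ u₁ u₂ : EuclideanSpace ℝ (Fin d)) (a b c : ℝ)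

lemma density_product_eq (x : EuclideanSpace ℝ (Fin d)) :
    gaussianDensity ν u₁ x ^ a * gaussianDensity ν u₂ x ^ b * gaussianDensity ν u₀ x ^ c =
      Real.exp (-(a * ‖u₁‖ ^ 2 + b * ‖u₂‖ ^ 2 + c * ‖u₀‖ ^ 2) / (2 * ν ^ 2)) *
        Real.exp ⟪(ν ^ 2)⁻¹ • (a • u₁ + b • u₂ + c • u₀), x⟫ := by
  simp only [gaussianDensity, ← Real.exp_mul, ← Real.exp_add, inner_smul_left, inner_add_left]
  congr 1
  simp
  ring

lemma integrable_density_product :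
    Integrable (fun x ↦ gaussianDensity ν u₁ x ^ a * gaussianDensity ν u₂ x ^ b *
      gaussianDensity ν u₀ x ^ c) (isoGaussian ν 0) := by
  simp only [density_product_eq]
  exact (integrable_exp_inner ν 0 _).const_mul _

/-- Completing the square. Because the exponents sum to 1, the result is translation invariant and
only differences from `u₀` survive. -/
lemma integral_density_product (hν : ν ≠ 0) (habc : a + b + c = 1) :
    ∫ x, gaussianDensity ν u₁ x ^ a * gaussianDensity ν u₂ x ^ b *
      gaussianDensity ν u₀ x ^ c ∂(isoGaussian ν 0) =
    Real.exp ((a * (a - 1) * ‖u₁ - u₀‖ ^ 2 + b * (b - 1) * ‖u₂ - u₀‖ ^ 2 +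
      2 * a * b * ⟪u₁ - u₀, u₂ - u₀⟫) / (2 * ν ^ 2)) := by
  simp only [density_product_eq]
  rw [integral_const_mul, integral_exp_inner, ← Real.exp_add]
  congr 1
  obtain rfl : c = 1 - a - b := by linarith
  simp only [inner_zero_right, norm_smul, mul_pow, norm_sub_sq_real, norm_add_sq_real,
    inner_add_left, inner_sub_left, inner_sub_right, inner_smul_left, inner_smul_right,
    real_inner_self_eq_norm_sq, Real.norm_eq_abs, sq_abs, conj_trivial]
  rw [real_inner_comm u₂ u₀]
  field_simp
  ring

end Moments

lemma isoGaussian_eq_withDensity {d : ℕ} {ν : ℝ} (hν : ν ≠ 0) (u : EuclideanSpace ℝ (Fin d)) :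
    isoGaussian ν u =
      (isoGaussian ν 0).withDensity (fun x ↦ ENNReal.ofReal (gaussianDensity ν u x)) := by
  have hint : Integrable (gaussianDensity ν u) (isoGaussian ν 0) := by
    simpa using integrable_density_product (ν := ν) 0 u 0 1 0 0
  have : IsFiniteMeasure ((isoGaussian ν 0).withDensity
      (fun x ↦ ENNReal.ofReal (gaussianDensity ν u x))) :=
    isFiniteMeasure_withDensity_ofReal hint.2
  apply Measure.ext_of_charFun
  ext t
  set Q := (isoGaussian ν 0).withDensity (fun x ↦ ENNReal.ofReal (gaussianDensity ν u x))
  set X : EuclideanSpace ℝ (Fin d) → ℝ := fun x ↦ ⟪t, x⟫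
  have hmgf : mgf X (isoGaussian ν u) = mgf X Q := by
    ext r
    have h1 : mgf X (isoGaussian ν u) r = ∫ x, Real.exp ⟪r • t, x⟫ ∂(isoGaussian ν u) := by
      simp [mgf, X, inner_smul_left]
    have h2 : mgf X Q r = Real.exp (- ‖u‖ ^ 2 / (2 * ν ^ 2)) *
        ∫ x, Real.exp ⟪r • t + (ν ^ 2)⁻¹ • u, x⟫ ∂(isoGaussian ν 0) := by
      rw [← integral_const_mul, mgf, integral_withDensity_eq_integral_toReal_smul (by fun_prop)
        (by simp)]
      congr 1 with x
      rw [ENNReal.toReal_ofReal (gaussianDensity_pos _ _ _).le, gaussianDensity, smul_eq_mul,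
        ← Real.exp_add, ← Real.exp_add, inner_add_left, inner_smul_left, inner_smul_left]
      congr 1
      simp [X]
      ring
    rw [h1, h2, integral_exp_inner, integral_exp_inner, ← Real.exp_add]
    congr 1
    simp only [inner_zero_right, norm_add_sq_real, norm_smul, inner_smul_left, inner_smul_right,
      mul_pow, Real.norm_eq_abs, sq_abs, conj_trivial]
    field_simp
    ring
  have hset : integrableExpSet X (isoGaussian ν u) = Set.univ := by
    ext r
    have := integrable_exp_inner ν u (r • t)
    simpa [integrableExpSet, X, inner_smul_left] using this
  -- Equal real moment generating functions, finite everywhere, continue analytically to the same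
  -- complex function; its value at `I` is the characteristic function.
  have := eqOn_complexMGF_of_mgf hmgf (x := Complex.I) (by simp [hset])
  simp only [complexMGF, X] at this
  rw [charFun_apply, charFun_apply]
  simpa [mul_comm, real_inner_comm] using this

/-! ### Upper bounds for real powers -/

/-- Bernoulli's inequality at `-x / (1 + x)`, multiplied by `(1 + x) ^ γ`. -/
lemma rpow_one_add_le_one_add_mul_rpow {x γ : ℝ} (hx : 0 ≤ x) (hγ : 1 ≤ γ) :
    (1 + x) ^ γ ≤ 1 + γ * x * (1 + x) ^ (γ - 1) := by
  have h1 : 0 < 1 + x := by linarith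
  have hb : 1 + γ * (-(x / (1 + x))) ≤ (1 + -(x / (1 + x))) ^ γ :=
    one_add_mul_self_le_rpow_one_add (by
      rw [neg_le_neg_iff, div_le_one h1]; linarith) hγ
  have he : 1 + -(x / (1 + x)) = (1 + x)⁻¹ := by field_simp; ring
  rw [he, Real.inv_rpow h1.le] at hb
  have hp : 0 < (1 + x) ^ γ := Real.rpow_pos_of_pos h1 _
  have h2 := mul_le_mul_of_nonneg_left hb hp.le
  rw [mul_inv_cancel₀ hp.ne'] at h2
  rw [Real.rpow_sub_one h1.ne']
  have h3 : (1 + x) ^ γ * (1 + γ * -(x / (1 + x))) =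
      (1 + x) ^ γ - γ * x * ((1 + x) ^ γ / (1 + x)) := by ring
  linarith

/-- For `x ≤ 1 / (γ + 1)` use `1 + x ≤ exp x`; otherwise `1 + x ≤ (γ + 2) x`. -/
lemma rpow_one_add_le_exp_add {x γ : ℝ} (hx : 0 ≤ x) (hγ : 0 ≤ γ) :
    (1 + x) ^ γ ≤ Real.exp 1 + (γ + 2) ^ γ * x ^ γ := by
  by_cases h : x * (γ + 1) ≤ 1
  · have h1 : (1 + x) ^ γ ≤ Real.exp x ^ γ :=
      Real.rpow_le_rpow (by linarith) (by linarith [Real.add_one_le_exp x]) hγ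
    rw [← Real.exp_mul] at h1
    have h2 : Real.exp (x * γ) ≤ Real.exp 1 := Real.exp_le_exp.2 (by linarith)
    have : 0 ≤ (γ + 2) ^ γ * x ^ γ := by positivity
    linarith
  · rw [← Real.mul_rpow (by linarith) hx]
    have h1 : (1 + x) ^ γ ≤ ((γ + 2) * x) ^ γ :=
      Real.rpow_le_rpow (by linarith) (by linarith) hγ
    linarith [Real.exp_pos 1]

/-- Second order Taylor bound for `(1 + t) ^ α` with `α ≥ 2`. -/
lemma rpow_one_add_le_taylor {α t : ℝ} (hα : 2 ≤ α) (ht : -1 ≤ t) :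
    (1 + t) ^ α ≤ 1 + α * t + α * (α - 1) / 2 * (t ^ 2 * (1 + max t 0) ^ (α - 2)) := by
  -- `K` is frozen at the endpoint `t`, so that `F'` stays simple. Bernoulli-type bounds give its
  -- sign on each side of 0, where `F` vanishes.
  set K := (1 + max t 0) ^ (α - 2) with hK
  let F : ℝ → ℝ := fun u ↦ 1 + α * u + α * (α - 1) / 2 * (u ^ 2 * K) - (1 + u) ^ α
  have hder (u : ℝ) : HasDerivAt F (α * (1 + (α - 1) * K * u - (1 + u) ^ (α - 1))) u := by
    have h1 : HasDerivAt (fun u : ℝ ↦ (1 + u) ^ α) (1 * α * (1 + u) ^ (α - 1)) u :=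
      ((hasDerivAt_id u).const_add 1).rpow_const (Or.inr (by linarith))
    have h2 := ((((hasDerivAt_id u).const_mul α).const_add 1).add
      ((((hasDerivAt_id u).pow 2).mul_const K).const_mul (α * (α - 1) / 2))).sub h1
    refine h2.congr_deriv ?_
    simp
    ring
  have hcont : Continuous F := continuous_iff_continuousAt.2 fun u ↦ (hder u).continuousAt
  have h0 : F 0 = 0 := by simp [F]
  suffices 0 ≤ F t by simp only [F] at this; linarith
  rcases le_total t 0 with h | h
  · have hK1 : K = 1 := by simp [hK, max_eq_right h]
    have hanti : AntitoneOn F (Set.Icc (-1) 0) := by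
      refine antitoneOn_of_hasDerivWithinAt_nonpos (convex_Icc _ _) hcont.continuousOn
        (fun u _ ↦ (hder u).hasDerivWithinAt) fun u hu ↦ ?_
      rw [interior_Icc] at hu
      have := one_add_mul_self_le_rpow_one_add (s := u) hu.1.le (p := α - 1) (by linarith)
      rw [hK1]
      exact mul_nonpos_of_nonneg_of_nonpos (by linarith) (by linarith)
    rw [← h0]
    exact hanti ⟨ht, h⟩ ⟨by norm_num, le_rfl⟩ h
  · have hmono : MonotoneOn F (Set.Icc 0 t) := by
      refine monotoneOn_of_hasDerivWithinAt_nonneg (convex_Icc _ _) hcont.continuousOn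
        (fun u _ ↦ (hder u).hasDerivWithinAt) fun u hu ↦ ?_
      rw [interior_Icc] at hu
      have h1 := rpow_one_add_le_one_add_mul_rpow (x := u) hu.1.le (γ := α - 1) (by linarith)
      rw [show α - 1 - 1 = α - 2 by ring] at h1
      have h2 : (1 + u) ^ (α - 2) ≤ K := by
        rw [hK, max_eq_left h]
        exact Real.rpow_le_rpow (by linarith [hu.1]) (by linarith [hu.2]) (by linarith)
      have h3 : (α - 1) * u * (1 + u) ^ (α - 2) ≤ (α - 1) * u * K :=
        mul_le_mul_of_nonneg_left h2 (mul_nonneg (by linarith) hu.1.le)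
      exact mul_nonneg (by linarith) (by linarith)
    rw [← h0]
    exact hmono ⟨le_rfl, h⟩ ⟨h, le_rfl⟩ h

/-- `(1 + t) ^ α` exceeds its linearization by at most `K (t² + L t₊³ + R t₊ ^ α)`. -/
structure PowerBound (α K L R : ℝ) : Prop where
  K_nonneg : 0 ≤ K
  L_nonneg : 0 ≤ L
  R_nonneg : 0 ≤ R
  le : ∀ t : ℝ, -1 ≤ t →
    (1 + t) ^ α ≤ 1 + α * t + K * (t ^ 2 + L * max t 0 ^ (3 : ℝ) + R * max t 0 ^ α)

/-- Multiply Bernoulli's inequality for the exponent `α - 1 ∈ [0, 1]` by `1 + t`. -/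
lemma powerBound_of_le_two {α : ℝ} (h1 : 1 < α) (h2 : α ≤ 2) : PowerBound α (α - 1) 0 0 where
  K_nonneg := by linarith
  L_nonneg := le_rfl
  R_nonneg := le_rfl
  le t ht := by
    have h3 := rpow_one_add_le_one_add_mul_self ht (p := α - 1) (by linarith) (by linarith)
    have h4 : (1 + t) ^ α = (1 + t) * (1 + t) ^ (α - 1) := by
      rcases ht.eq_or_lt with rfl | h
      · simp [Real.zero_rpow (show α ≠ 0 by linarith)]
      · rw [Real.rpow_sub_one (by linarith)]
        field_simp [show 1 + t ≠ 0 by linarith]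
    rw [h4]
    nlinarith [mul_le_mul_of_nonneg_left h3 (show 0 ≤ 1 + t by linarith)]

/-- Taylor's bound, with Bernoulli's inequality for the exponent `α - 2 ∈ [0, 1]` applied to the
remainder factor. -/
lemma powerBound_of_le_three {α : ℝ} (h1 : 2 ≤ α) (h2 : α ≤ 3) :
    PowerBound α (α * (α - 1) / 2) (α - 2) 0 where
  K_nonneg := by nlinarith
  L_nonneg := by linarith
  R_nonneg := le_rfl
  le t ht := by
    refine (rpow_one_add_le_taylor h1 ht).trans ?_
    have h3 := rpow_one_add_le_one_add_mul_self (s := max t 0)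
      (by linarith [le_max_right t 0]) (p := α - 2) (by linarith) (by linarith)
    gcongr 1 + α * t + ?_
    refine mul_le_mul_of_nonneg_left ?_ (by nlinarith)
    refine (mul_le_mul_of_nonneg_left h3 (sq_nonneg t)).trans_eq ?_
    rw [show (3 : ℝ) = ((3 : ℕ) : ℝ) by norm_num, Real.rpow_natCast]
    rcases le_total t 0 with h | h
    · simp [max_eq_right h]
    · rw [max_eq_left h]; ring

/-- In Taylor's remainder, `(1 + t) ^ (α - 2)` is first linearized, then the leftover `(1 + t) ^ (α
- 3)` is split into a constant, giving the cubic term, and a pure power, giving `t ^ α`. -/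
lemma powerBound_of_three_le {α : ℝ} (h1 : 3 ≤ α) :
    PowerBound α (α * (α - 1) / 2) (Real.exp 1 * (α - 2))
      ((α - 2) * (α - 1) ^ (α - 3)) where
  K_nonneg := by nlinarith
  L_nonneg := mul_nonneg (Real.exp_pos 1).le (by linarith)
  R_nonneg := mul_nonneg (by linarith) (Real.rpow_nonneg (by linarith) _)
  le t ht := by
    refine (rpow_one_add_le_taylor (by linarith) ht).trans ?_
    gcongr 1 + α * t + ?_
    refine mul_le_mul_of_nonneg_left ?_ (by nlinarith)
    rcases le_total t 0 with h | h
    · simp [max_eq_right h, Real.zero_rpow (show α ≠ 0 by linarith)]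
    · rw [max_eq_left h]
      have h2 := rpow_one_add_le_one_add_mul_rpow h (γ := α - 2) (by linarith)
      rw [show α - 2 - 1 = α - 3 by ring] at h2
      have h3 := rpow_one_add_le_exp_add h (γ := α - 3) (by linarith)
      rw [show α - 3 + 2 = α - 1 by ring] at h3
      have h4 : t ^ α = t ^ 3 * t ^ (α - 3) := by
        rw [← Real.rpow_natCast, ← Real.rpow_add_of_nonneg h (by norm_num) (by linarith)]
        congr 1; norm_num
      rw [show (3 : ℝ) = ((3 : ℕ) : ℝ) by norm_num, Real.rpow_natCast, h4]
      push_cast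
      have h5 := mul_le_mul_of_nonneg_left h3 (show 0 ≤ (α - 2) * t from
        mul_nonneg (by linarith) h)
      calc t ^ 2 * (1 + t) ^ (α - 2)
          ≤ t ^ 2 * (1 + (α - 2) * t * (Real.exp 1 + (α - 1) ^ (α - 3) * t ^ (α - 3))) := by
            gcongr; linarith
        _ = _ := by ring

/-! ### Numerical estimates -/

/-- The left side is `2 y (y - 1)` with `y = exp (s / 2)`. The chord of `exp` over `[0, 3/4]` bounds
`y - 1`, and `y ≤ exp (3/4) ≤ 2.118`; finally `2 · 2.118 · 1.118 · 2/3 < 3.2`. -/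
lemma exp_sub_exp_half_le {s : ℝ} (h0 : 0 ≤ s) (h1 : s ≤ 3 / 2) :
    2 * Real.exp s - 2 * Real.exp (s / 2) ≤ 3.2 * s := by
  have he : Real.exp (3 / 4) ≤ 2.118 := by
    refine le_of_pow_le_pow_left₀ (n := 4) (by norm_num) (by norm_num) ?_
    rw [← Real.exp_nat_mul]
    calc Real.exp ((4 : ℕ) * (3 / 4)) = Real.exp 1 ^ 3 := by
          rw [← Real.exp_nat_mul]; norm_num
      _ ≤ 2.7182818286 ^ 3 := by gcongr; exact Real.exp_one_lt_d9.le
      _ ≤ _ := by norm_num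
  have hc := convexOn_exp.2 (Set.mem_univ 0) (Set.mem_univ (3 / 4 : ℝ))
    (show 0 ≤ 1 - 2 * s / 3 by linarith) (show 0 ≤ 2 * s / 3 by linarith) (by ring)
  simp only [smul_eq_mul, mul_zero, zero_add, Real.exp_zero] at hc
  rw [show 2 * s / 3 * (3 / 4) = s / 2 by ring] at hc
  have hm : Real.exp (s / 2) ≤ 2.118 :=
    (Real.exp_le_exp.2 (by linarith)).trans he
  have hs : Real.exp s = Real.exp (s / 2) * Real.exp (s / 2) := by
    rw [← Real.exp_add]; congr 1; ring
  have h2 : Real.exp (s / 2) - 1 ≤ 2 * s / 3 * 1.118 := by nlinarith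
  have h3 := mul_le_mul_of_nonneg_left h2 (Real.exp_pos (s / 2)).le
  have h4 := mul_le_mul_of_nonneg_right hm (show 0 ≤ 2 * s / 3 * 1.118 by positivity)
  rw [hs]
  nlinarith

lemma exp_nine_quarters_le : Real.exp (9 / 4) ≤ 10 := by
  refine le_of_pow_le_pow_left₀ (n := 4) (by norm_num) (by norm_num) ?_
  rw [← Real.exp_nat_mul]
  calc Real.exp ((4 : ℕ) * (9 / 4)) = Real.exp 1 ^ 9 := by
        rw [← Real.exp_nat_mul]; norm_num
    _ ≤ 2.7182818286 ^ 9 := by gcongr; exact Real.exp_one_lt_d9.le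
    _ ≤ _ := by norm_num

/-- The sampling rate is small enough for the higher order terms to be dominated. -/
lemma exists_powerBound {α s τ : ℝ} (hα : 1 < α) (hs : 0 < s) (hs' : s ≤ 3 / 2) (hτ : 0 < τ)
    (h : α * τ * (1 + 1 / s) ≤ Real.exp (-(3 / 2 * (α - 1) * s))) :
    ∃ K L R, PowerBound α K L R ∧
      K * (3.2 * s + L * (τ * Real.exp (3 * s)) +
        R * (τ ^ (α - 2) * Real.exp (α * (α - 1) * s / 2))) ≤ 3.5 * α * (α - 1) * s := by
  have h' : α * τ ≤ s / (1 + s) * Real.exp (-(3 / 2 * (α - 1) * s)) := by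
    calc α * τ = s / (1 + s) * (α * τ * (1 + 1 / s)) := by field_simp; ring
      _ ≤ _ := by gcongr
  have hs1 : s / (1 + s) ≤ s := div_le_self hs.le (by linarith)
  -- `exp (3 s)` bounds the third moment.
  have h3 : α * (τ * Real.exp (3 * s)) ≤ s * Real.exp (3 / 2 * (3 - α) * s) := by
    calc α * (τ * Real.exp (3 * s)) = α * τ * Real.exp (3 * s) := by ring
      _ ≤ (s * Real.exp (-(3 / 2 * (α - 1) * s))) * Real.exp (3 * s) := by
        refine mul_le_mul_of_nonneg_right (h'.trans ?_) (Real.exp_pos _).le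
        gcongr
      _ = _ := by rw [mul_assoc, ← Real.exp_add]; congr 2; ring
  have hy : 0 < τ * Real.exp (3 * s) := by positivity
  rcases le_total α 2 with h2 | h2
  · exact ⟨_, _, _, powerBound_of_le_two hα h2, by nlinarith [mul_pos (sub_pos.2 hα) hs]⟩
  have hK : 0 ≤ α * (α - 1) / 2 := by nlinarith
  -- From here on `K = α (α - 1) / 2`, so the total budget is `7 s`.
  have key {y : ℝ} (hy : y ≤ 7 * s) : α * (α - 1) / 2 * y ≤ 3.5 * α * (α - 1) * s :=
    (mul_le_mul_of_nonneg_left hy hK).trans_eq (by ring)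
  rcases le_total α 3 with h4 | h4
  · refine ⟨_, _, _, powerBound_of_le_three h2 h4, key ?_⟩
    have h5 : Real.exp (3 / 2 * (3 - α) * s) ≤ 10 :=
      (Real.exp_le_exp.2 (by nlinarith)).trans exp_nine_quarters_le
    -- `3 (α - 2) ≤ α` for `α ≤ 3`; the sum is then at most `(3.2 + 10/3) s < 7 s`.
    have h6 : 3 * ((α - 2) * (τ * Real.exp (3 * s))) ≤ α * (τ * Real.exp (3 * s)) := by
      nlinarith
    have h7 := mul_le_mul_of_nonneg_left h5 hs.le
    linarith
  · refine ⟨_, _, _, powerBound_of_three_le h4, key ?_⟩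
    -- For `α ≥ 3` the three terms cost at most `3.2 s`, `e s` and `s`, and `3.2 + e + 1 < 7`.
    have h5 : Real.exp (3 / 2 * (3 - α) * s) ≤ 1 :=
      Real.exp_le_one_iff.2 (by nlinarith)
    have h6 : (α - 2) * (τ * Real.exp (3 * s)) ≤ s := by
      have : (α - 2) * (τ * Real.exp (3 * s)) ≤ α * (τ * Real.exp (3 * s)) := by nlinarith
      nlinarith
    have h7 : Real.exp 1 * ((α - 2) * (τ * Real.exp (3 * s))) ≤ 2.7182818286 * s :=
      mul_le_mul Real.exp_one_lt_d9.le h6 (mul_nonneg (by linarith) hy.le) (by norm_num)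
    have h8 : (α - 2) * (α - 1) ^ (α - 3) * τ ^ (α - 2) ≤ (α * τ) ^ (α - 2) := by
      rw [Real.mul_rpow (by linarith) hτ.le]
      gcongr
      calc (α - 2) * (α - 1) ^ (α - 3) ≤ α * α ^ (α - 3) := by
            gcongr <;> linarith
        _ = α ^ (α - 2) := by
          rw [← Real.rpow_one_add' (by linarith) (by linarith)]; congr 1; ring
    have h9 : (α * τ) ^ (α - 2) ≤ s * Real.exp (-(3 / 2 * (α - 1) * s) * (α - 2)) := by
      refine (Real.rpow_le_rpow (by positivity) h' (by linarith)).trans ?_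
      rw [Real.mul_rpow (by positivity) (Real.exp_pos _).le, ← Real.exp_mul]
      gcongr
      -- The base `s / (1 + s)` is below 1 and the exponent `α - 2` at least 1, so one factor `s`
      -- survives even when `s > 1`.
      refine le_trans ?_ hs1
      refine Real.rpow_le_self_of_le_one (by positivity) ?_ (by linarith)
      rw [div_le_one (by linarith)]; linarith
    have h10 : (α - 2) * (α - 1) ^ (α - 3) *
        (τ ^ (α - 2) * Real.exp (α * (α - 1) * s / 2)) ≤ s := by
      calc _ = (α - 2) * (α - 1) ^ (α - 3) * τ ^ (α - 2) *
            Real.exp (α * (α - 1) * s / 2) := by ring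
        _ ≤ s * Real.exp (-(3 / 2 * (α - 1) * s) * (α - 2)) *
            Real.exp (α * (α - 1) * s / 2) := by
          exact mul_le_mul_of_nonneg_right (h8.trans h9) (Real.exp_pos _).le
        -- The decay from the bound on `τ` beats the growth of the `α`-moment exactly when `α ≥ 3`.
        _ = s * Real.exp (-((α - 1) * (α - 3) * s)) := by
          rw [mul_assoc, ← Real.exp_add]; congr 2; ring
        _ ≤ s * 1 := by
          gcongr
          refine Real.exp_le_one_iff.2 (neg_nonpos.2 ?_)
          exact mul_nonneg (mul_nonneg (by linarith) (by linarith)) hs.le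
        _ = s := mul_one s
    linarith

/-- With `x = exp (s A / 2)`, `y = exp (s B / 2)`, `E = exp (s / 2)`, the constraint gives `exp (s
c) ≥ x y / E`. On `[1, E]²` the expression `x² + y² - 2 x y / E` does not decrease when `x`, and
then `y`, is moved to `E`. -/
lemma exp_quadratic_le {s A B c : ℝ} (hs : 0 ≤ s) (hs' : s ≤ 3 / 2) (hA : 0 ≤ A) (hA' : A ≤ 1)
    (hB : 0 ≤ B) (hB' : B ≤ 1) (hc : A + B - 1 ≤ 2 * c) :
    Real.exp (s * A) + Real.exp (s * B) - 2 * Real.exp (s * c) ≤ 3.2 * s := by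
  refine le_trans ?_ (exp_sub_exp_half_le hs hs')
  set x := Real.exp (s * A / 2)
  set y := Real.exp (s * B / 2)
  set E := Real.exp (s / 2)
  have hx : 1 ≤ x := Real.one_le_exp (by positivity)
  have hy : 1 ≤ y := Real.one_le_exp (by positivity)
  have hxE : x ≤ E := Real.exp_le_exp.2 (by nlinarith)
  have hyE : y ≤ E := Real.exp_le_exp.2 (by nlinarith)
  have h1 : Real.exp (s * A) = x ^ 2 := by
    rw [← Real.exp_nat_mul]; congr 1; push_cast; ring
  have h2 : Real.exp (s * B) = y ^ 2 := by
    rw [← Real.exp_nat_mul]; congr 1; push_cast; ring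
  have h3 : Real.exp s = E ^ 2 := by
    rw [← Real.exp_nat_mul]; congr 1; push_cast; ring
  have hE : 0 < E := Real.exp_pos _
  have h4 : x * y / E ≤ Real.exp (s * c) := by
    rw [← Real.exp_add, ← Real.exp_sub]
    exact Real.exp_le_exp.2 (by nlinarith)
  rw [h1, h2, h3]
  have h5 : x ^ 2 + y ^ 2 - 2 * (x * y / E) ≤ 2 * E ^ 2 - 2 * E := by
    have h6 : 0 ≤ (E - x) * (E + x - 2 * (y / E)) := by
      have : y / E ≤ 1 := (div_le_one hE).2 hyE
      exact mul_nonneg (by linarith) (by linarith)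
    have h7 : 0 ≤ (E - y) * (E + y - 2) := mul_nonneg (by linarith) (by linarith)
    have h8 : (E - x) * (E + x - 2 * (y / E)) = E ^ 2 - x ^ 2 - 2 * y + 2 * (x * y / E) := by
      field_simp; ring
    nlinarith
  linarith

/-! ### Pointwise inequalities between densities -/

/-- Convexity of a nonpositive power, from weighted AM-GM applied to the bases (reversed by `r ≤ 0`)
and to the powers. -/
lemma rpow_mix_le {x y τ r : ℝ} (hx : 0 < x) (hy : 0 < y) (h0 : 0 ≤ τ) (h1 : τ ≤ 1)
    (hr : r ≤ 0) : ((1 - τ) * x + τ * y) ^ r ≤ (1 - τ) * x ^ r + τ * y ^ r := by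
  have hτ : 0 ≤ 1 - τ := by linarith
  have h2 := Real.geom_mean_le_arith_mean2_weighted hτ h0 hx.le hy.le (by ring)
  have h3 := Real.geom_mean_le_arith_mean2_weighted hτ h0 (Real.rpow_nonneg hx.le r)
    (Real.rpow_nonneg hy.le r) (by ring)
  refine (Real.rpow_le_rpow_of_nonpos (by positivity) h2 hr).trans (le_trans (le_of_eq ?_) h3)
  rw [Real.mul_rpow (by positivity) (by positivity), ← Real.rpow_mul hx.le,
    ← Real.rpow_mul hy.le, ← Real.rpow_mul hx.le, ← Real.rpow_mul hy.le, mul_comm r, mul_comm r]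

/-- `(p, q) ↦ p ^ α q ^ (1 - α)` is subadditive. -/
lemma add_rpow_mul_add_rpow_le {α p₁ p₂ q₁ q₂ : ℝ} (hα : 1 ≤ α) (hp₁ : 0 ≤ p₁) (hp₂ : 0 ≤ p₂)
    (hq₁ : 0 < q₁) (hq₂ : 0 < q₂) :
    (p₁ + p₂) ^ α * (q₁ + q₂) ^ (1 - α) ≤ p₁ ^ α * q₁ ^ (1 - α) + p₂ ^ α * q₂ ^ (1 - α) := by
  have hQ : 0 < q₁ + q₂ := by linarith
  -- Jensen for `t ^ α` at the ratios `pᵢ / qᵢ` with weights `qᵢ / (q₁ + q₂)`.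
  have h := (convexOn_rpow hα).2 (div_nonneg hp₁ hq₁.le) (div_nonneg hp₂ hq₂.le)
    (div_nonneg hq₁.le hQ.le) (div_nonneg hq₂.le hQ.le) (by field_simp)
  simp only [smul_eq_mul] at h
  rw [show q₁ / (q₁ + q₂) * (p₁ / q₁) + q₂ / (q₁ + q₂) * (p₂ / q₂) = (p₁ + p₂) / (q₁ + q₂) by
    field_simp, Real.div_rpow (by linarith) hQ.le, Real.div_rpow hp₁ hq₁.le,
    Real.div_rpow hp₂ hq₂.le] at h
  simp only [Real.rpow_sub hQ, Real.rpow_sub hq₁, Real.rpow_sub hq₂, Real.rpow_one]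
  have h2 := mul_le_mul_of_nonneg_left h hQ.le
  refine (le_of_eq ?_).trans (h2.trans_eq ?_)
  · ring
  · field_simp

lemma multiset_sum_map_pos {ι : Type*} {q : ι → ℝ} (hq : ∀ i, 0 < q i) {W : Multiset ι}
    (hW : 0 < W.card) : 0 < (W.map q).sum := by
  obtain ⟨j, hj⟩ := Multiset.card_pos_iff_exists_mem.1 hW
  obtain ⟨V, rfl⟩ := Multiset.exists_cons_of_mem hj
  simp only [Multiset.map_cons, Multiset.sum_cons]
  exact add_pos_of_pos_of_nonneg (hq j)
    (Multiset.sum_nonneg (by simpa using fun i _ ↦ (hq i).le))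

lemma multiset_sum_rpow_le {ι : Type*} {α : ℝ} (hα : 1 < α) {p q : ι → ℝ} (hp : ∀ i, 0 ≤ p i)
    (hq : ∀ i, 0 < q i) (W : Multiset ι) :
    (W.map p).sum ^ α * (W.map q).sum ^ (1 - α) ≤
      (W.map fun i ↦ p i ^ α * q i ^ (1 - α)).sum := by
  induction W using Multiset.induction with
  | empty => simp [Real.zero_rpow (show α ≠ 0 by linarith)]
  | cons i W ih =>
    simp only [Multiset.map_cons, Multiset.sum_cons]
    rcases W.card.eq_zero_or_pos with h | h
    · simp [Multiset.card_eq_zero.1 h]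
    · have hP : 0 ≤ (W.map p).sum := Multiset.sum_nonneg (by simpa using fun i _ ↦ hp i)
      have := add_rpow_mul_add_rpow_le hα.le (hp i) hP (hq i) (multiset_sum_map_pos hq h)
      linarith

/-- The `j`-th moment `a ^ j g ^ (1 - j)`. -/
noncomputable def momentTerm (j a g : ℝ) : ℝ := a ^ j * g ^ (1 - j)

/-- The ternary `χ²` term `(a - b)² / g`. -/
noncomputable def chiTerm (a b g : ℝ) : ℝ := (a - b) ^ 2 / g

/-- Apply the power bound to the relative perturbation `x`. The linear term is kept with its sign so
that it can integrate to zero; the other terms are spread over `g` and `b` by `rpow_mix_le`. -/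
lemma mixture_rpow_le {α K L R g a b τ : ℝ} (hα : 1 < α) (H : PowerBound α K L R) (hg : 0 < g)
    (ha : 0 < a) (hb : 0 < b) (h0 : 0 < τ) (h1 : τ < 1) :
    ((1 - τ) * g + τ * a) ^ α * ((1 - τ) * g + τ * b) ^ (1 - α) ≤
      ((1 - τ) * g + τ * b) + α * τ * (a - b) +
      K * (τ ^ 2 * ((1 - τ) * chiTerm a b g + τ * chiTerm a b b) +
        L * (τ ^ 3 * ((1 - τ) * momentTerm 3 a g + τ * momentTerm 3 a b)) +
        R * (τ ^ α * ((1 - τ) * momentTerm α a g + τ * momentTerm α a b))) := by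
  have hτ : 0 < 1 - τ := by linarith
  set q := (1 - τ) * g + τ * b with hq
  have hq0 : 0 < q := by positivity
  set x := τ * (a - b) / q with hx
  have hx1 : 1 + x = ((1 - τ) * g + τ * a) / q := by rw [hx, hq]; field_simp; ring
  have hx0 : -1 ≤ x := by
    have : 0 < 1 + x := by rw [hx1]; positivity
    linarith
  have hlhs : ((1 - τ) * g + τ * a) ^ α * q ^ (1 - α) = q * (1 + x) ^ α := by
    rw [hx1, Real.div_rpow (by positivity) hq0.le, Real.rpow_sub hq0, Real.rpow_one]
    ring
  have hmom {j : ℝ} (hj : 1 ≤ j) : q * max x 0 ^ j ≤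
      τ ^ j * ((1 - τ) * momentTerm j a g + τ * momentTerm j a b) := by
    have h2 : max x 0 ≤ τ * a / q := by
      refine max_le ?_ (by positivity)
      rw [hx]; gcongr; linarith
    calc q * max x 0 ^ j ≤ q * (τ * a / q) ^ j := by
          gcongr
      _ = τ ^ j * a ^ j * q ^ (1 - j) := by
          rw [Real.div_rpow (by positivity) hq0.le, Real.mul_rpow h0.le ha.le,
            Real.rpow_sub hq0, Real.rpow_one]
          ring
      _ ≤ τ ^ j * a ^ j * ((1 - τ) * g ^ (1 - j) + τ * b ^ (1 - j)) := by
          gcongr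
          exact rpow_mix_le hg hb h0.le h1.le (by linarith)
      _ = _ := by simp only [momentTerm]; ring
  have hchi : q * x ^ 2 ≤ τ ^ 2 * ((1 - τ) * chiTerm a b g + τ * chiTerm a b b) := by
    calc q * x ^ 2 = τ ^ 2 * (a - b) ^ 2 * q ^ (-1 : ℝ) := by
          rw [hx, Real.rpow_neg_one]; field_simp
      _ ≤ τ ^ 2 * (a - b) ^ 2 * ((1 - τ) * g ^ (-1 : ℝ) + τ * b ^ (-1 : ℝ)) := by
          gcongr
          exact rpow_mix_le hg hb h0.le h1.le (by norm_num)
      _ = _ := by simp only [chiTerm, Real.rpow_neg_one]; ring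
  have h3 : q * max x 0 ^ (3 : ℝ) ≤
      τ ^ 3 * ((1 - τ) * momentTerm 3 a g + τ * momentTerm 3 a b) := by
    refine (hmom (by norm_num)).trans_eq ?_
    congr 1
    exact_mod_cast Real.rpow_natCast τ 3
  rw [hlhs]
  calc q * (1 + x) ^ α
      ≤ q * (1 + α * x + K * (x ^ 2 + L * max x 0 ^ (3 : ℝ) + R * max x 0 ^ α)) := by
        gcongr; exact H.le x hx0
    _ = q + α * τ * (a - b) + K * (q * x ^ 2 + L * (q * max x 0 ^ (3 : ℝ)) +
          R * (q * max x 0 ^ α)) := by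
        have : q * x = τ * (a - b) := by rw [hx]; field_simp
        linear_combination α * this
    _ ≤ _ := by
        have := H.K_nonneg
        have := H.L_nonneg
        have := H.R_nonneg
        have h4 := hmom hα.le
        gcongr

/-! ### Gaussian integrals -/

/-- `f` is integrable with integral at most `c`. -/
def IntegralLE {E : Type*} [MeasurableSpace E] (γ : Measure E) (f : E → ℝ) (c : ℝ) : Prop :=
  Integrable f γ ∧ ∫ x, f x ∂γ ≤ c

namespace IntegralLE

variable {E : Type*} [MeasurableSpace E] {γ : Measure E} {f g : E → ℝ} {b c : ℝ}

lemma add (hf : IntegralLE γ f b) (hg : IntegralLE γ g c) :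
    IntegralLE γ (fun x ↦ f x + g x) (b + c) :=
  ⟨hf.1.add hg.1, (integral_add hf.1 hg.1).trans_le (add_le_add hf.2 hg.2)⟩

lemma const_mul (hf : IntegralLE γ f c) (hb : 0 ≤ b) :
    IntegralLE γ (fun x ↦ b * f x) (b * c) :=
  ⟨hf.1.const_mul b, (integral_const_mul b f).trans_le (mul_le_mul_of_nonneg_left hf.2 hb)⟩

lemma mono (hf : IntegralLE γ f b) (hbc : b ≤ c) : IntegralLE γ f c :=
  ⟨hf.1, hf.2.trans hbc⟩

lemma multiset_sum {ι : Type*} {F : ι → E → ℝ} (W : Multiset ι)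
    (h : ∀ i ∈ W, IntegralLE γ (F i) c) :
    IntegralLE γ (fun x ↦ (W.map fun i ↦ F i x).sum) (W.card * c) := by
  induction W using Multiset.induction with
  | empty => simp [IntegralLE]
  | cons i W ih =>
    simp only [Multiset.map_cons, Multiset.sum_cons, Multiset.card_cons]
    exact ((h i (by simp)).add (ih fun j hj ↦ h j (by simp [hj]))).mono
      (by push_cast; linarith)

end IntegralLE

section Integrals

variable {d : ℕ} {ν : ℝ} (u₀ u₁ u₂ : EuclideanSpace ℝ (Fin d))

lemma integrable_gaussianDensity : Integrable (gaussianDensity ν u₁) (isoGaussian ν 0) := by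
  simpa using integrable_density_product (ν := ν) 0 u₁ 0 1 0 0

lemma integral_gaussianDensity (hν : ν ≠ 0) :
    ∫ x, gaussianDensity ν u₁ x ∂(isoGaussian ν 0) = 1 := by
  simpa using integral_density_product (ν := ν) 0 u₁ 0 1 0 0 hν (by norm_num)

lemma momentTerm_eq (j a g : ℝ) : momentTerm j a g = a ^ j * a ^ (0 : ℝ) * g ^ (1 - j) := by
  simp [momentTerm]

lemma integrable_momentTerm (j : ℝ) :
    Integrable (fun x ↦ momentTerm j (gaussianDensity ν u₁ x) (gaussianDensity ν u₀ x))
      (isoGaussian ν 0) := by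
  simp only [momentTerm_eq]
  exact integrable_density_product u₀ u₁ u₁ j 0 (1 - j)

lemma integral_momentTerm_le (hν : ν ≠ 0) {j : ℝ} (hj : 1 ≤ j) (h : ‖u₁ - u₀‖ ≤ 1) :
    ∫ x, momentTerm j (gaussianDensity ν u₁ x) (gaussianDensity ν u₀ x) ∂(isoGaussian ν 0) ≤
      Real.exp (j * (j - 1) * (1 / ν ^ 2) / 2) := by
  simp only [momentTerm_eq]
  rw [integral_density_product u₀ u₁ u₁ j 0 (1 - j) hν (by ring)]
  refine Real.exp_le_exp.2 ?_
  have h2 : ‖u₁ - u₀‖ ^ 2 ≤ 1 := pow_le_one₀ (norm_nonneg _) h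
  calc _ = j * (j - 1) * ‖u₁ - u₀‖ ^ 2 / (2 * ν ^ 2) := by ring
    _ ≤ j * (j - 1) * 1 / (2 * ν ^ 2) := by
        have : 0 ≤ j * (j - 1) := mul_nonneg (by linarith) (by linarith)
        gcongr
    _ = _ := by field_simp

lemma chiTerm_eq {a b g : ℝ} (hg : 0 < g) :
    chiTerm a b g = a ^ (2 : ℝ) * b ^ (0 : ℝ) * g ^ (-1 : ℝ) +
      a ^ (0 : ℝ) * b ^ (2 : ℝ) * g ^ (-1 : ℝ) -
      2 * (a ^ (1 : ℝ) * b ^ (1 : ℝ) * g ^ (-1 : ℝ)) := by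
  simp only [chiTerm, Real.rpow_zero, Real.rpow_one, Real.rpow_neg_one, Real.rpow_two]
  field_simp
  ring

lemma chiTerm_gaussian_eq (x : EuclideanSpace ℝ (Fin d)) :
    chiTerm (gaussianDensity ν u₁ x) (gaussianDensity ν u₂ x) (gaussianDensity ν u₀ x) =
      gaussianDensity ν u₁ x ^ (2 : ℝ) * gaussianDensity ν u₂ x ^ (0 : ℝ) *
        gaussianDensity ν u₀ x ^ (-1 : ℝ) +
      gaussianDensity ν u₁ x ^ (0 : ℝ) * gaussianDensity ν u₂ x ^ (2 : ℝ) *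
        gaussianDensity ν u₀ x ^ (-1 : ℝ) -
      2 * (gaussianDensity ν u₁ x ^ (1 : ℝ) * gaussianDensity ν u₂ x ^ (1 : ℝ) *
        gaussianDensity ν u₀ x ^ (-1 : ℝ)) :=
  chiTerm_eq (gaussianDensity_pos ..)

lemma integrable_chiTerm :
    Integrable (fun x ↦ chiTerm (gaussianDensity ν u₁ x) (gaussianDensity ν u₂ x)
      (gaussianDensity ν u₀ x)) (isoGaussian ν 0) := by
  simp only [chiTerm_gaussian_eq]
  exact ((integrable_density_product u₀ u₁ u₂ _ _ _).add
    (integrable_density_product u₀ u₁ u₂ _ _ _)).sub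
    ((integrable_density_product u₀ u₁ u₂ _ _ _).const_mul _)

lemma integral_chiTerm_le (hν : 2 / 3 ≤ ν ^ 2) (h₁ : ‖u₁ - u₀‖ ≤ 1) (h₂ : ‖u₂ - u₀‖ ≤ 1)
    (h₃ : ‖u₁ - u₂‖ ≤ 1) :
    ∫ x, chiTerm (gaussianDensity ν u₁ x) (gaussianDensity ν u₂ x) (gaussianDensity ν u₀ x)
      ∂(isoGaussian ν 0) ≤ 3.2 * (1 / ν ^ 2) := by
  have hν0 : ν ≠ 0 := by rintro rfl; norm_num at hν
  simp only [chiTerm_gaussian_eq]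
  have i1 := integrable_density_product (ν := ν) u₀ u₁ u₂ 2 0 (-1)
  have i2 := integrable_density_product (ν := ν) u₀ u₁ u₂ 0 2 (-1)
  have i3 := integrable_density_product (ν := ν) u₀ u₁ u₂ 1 1 (-1)
  refine (integral_sub (i1.add i2) (i3.const_mul 2)).trans_le ?_
  rw [integral_add' i1 i2, integral_const_mul,
    integral_density_product _ _ _ _ _ _ hν0 (by norm_num),
    integral_density_product _ _ _ _ _ _ hν0 (by norm_num),
    integral_density_product _ _ _ _ _ _ hν0 (by norm_num)]
  have hs : 1 / ν ^ 2 ≤ 3 / 2 := by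
    rw [div_le_div_iff₀ (by positivity) (by norm_num)]; linarith
  -- Polarization turns `‖u₁ - u₂‖ ≤ 1` into the constraint `A + B - 1 ≤ 2 c`.
  have hn := norm_sub_sq_real (u₁ - u₀) (u₂ - u₀)
  rw [sub_sub_sub_cancel_right] at hn
  have h4 : ‖u₁ - u₂‖ ^ 2 ≤ 1 := pow_le_one₀ (norm_nonneg _) h₃
  have := exp_quadratic_le (s := 1 / ν ^ 2) (A := ‖u₁ - u₀‖ ^ 2) (B := ‖u₂ - u₀‖ ^ 2)
    (c := ⟪u₁ - u₀, u₂ - u₀⟫) (by positivity) hs (by positivity)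
    (pow_le_one₀ (norm_nonneg _) h₁) (by positivity) (pow_le_one₀ (norm_nonneg _) h₂)
    (by linarith)
  convert this using 3
  · congr 1; field_simp; ring
  · congr 1; field_simp; ring
  · congr 1; field_simp; ring

/-- The `α`-moment of the likelihood ratio of two Gaussian mixtures sharing a component is
dominated by an integrable function with small integral. -/
lemma exists_integrable_bound {α τ : ℝ} (hν : 2 / 3 ≤ ν ^ 2) (hα : 1 < α) (h0 : 0 < τ)
    (h1 : τ < 1)
    (h : α * τ * (1 + ν ^ 2) ≤ Real.exp (-(3 / 2 * (α - 1) * (1 / ν ^ 2))))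
    (h₁ : ‖u₁ - u₀‖ ≤ 1) (h₂ : ‖u₂ - u₀‖ ≤ 1) (h₃ : ‖u₁ - u₂‖ ≤ 1) :
    ∃ B : EuclideanSpace ℝ (Fin d) → ℝ,
      IntegralLE (isoGaussian ν 0) B (1 + 3.5 * τ ^ 2 * α * (α - 1) / ν ^ 2) ∧
      ∀ x, ((1 - τ) * gaussianDensity ν u₀ x + τ * gaussianDensity ν u₁ x) ^ α *
        ((1 - τ) * gaussianDensity ν u₀ x + τ * gaussianDensity ν u₂ x) ^ (1 - α) ≤ B x := by
  have hν0 : ν ≠ 0 := by rintro rfl; norm_num at hν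
  have hs : 1 / ν ^ 2 ≤ 3 / 2 := by
    rw [div_le_div_iff₀ (by positivity) (by norm_num)]; linarith
  obtain ⟨K, L, R, H, hKLR⟩ := exists_powerBound (s := 1 / ν ^ 2) hα (by positivity) hs h0
    (by simpa using h)
  have hK := H.K_nonneg
  have hL := H.L_nonneg
  have hR := H.R_nonneg
  have hτ : 0 ≤ 1 - τ := by linarith
  have mix {c : ℝ} {F : EuclideanSpace ℝ (Fin d) → EuclideanSpace ℝ (Fin d) → ℝ}
      (h₀ : IntegralLE (isoGaussian ν 0) (F u₀) c) (h₂ : IntegralLE (isoGaussian ν 0) (F u₂) c) :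
      IntegralLE (isoGaussian ν 0) (fun x ↦ (1 - τ) * F u₀ x + τ * F u₂ x) c :=
    ((h₀.const_mul hτ).add (h₂.const_mul h0.le)).mono (by linarith)
  have ig (u : EuclideanSpace ℝ (Fin d)) :
      IntegralLE (isoGaussian ν 0) (gaussianDensity ν u) 1 :=
    ⟨integrable_gaussianDensity u, (integral_gaussianDensity u hν0).le⟩
  have il : IntegralLE (isoGaussian ν 0)
      (fun x ↦ α * τ * (gaussianDensity ν u₁ x - gaussianDensity ν u₂ x)) 0 := by
    refine ⟨((ig u₁).1.sub (ig u₂).1).const_mul _, ?_⟩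
    rw [integral_const_mul, integral_sub (ig u₁).1 (ig u₂).1, integral_gaussianDensity _ hν0,
      integral_gaussianDensity _ hν0, sub_self, mul_zero]
  have im {j : ℝ} (hj : 1 ≤ j) := mix
    (F := fun u x ↦ momentTerm j (gaussianDensity ν u₁ x) (gaussianDensity ν u x))
    ⟨integrable_momentTerm u₀ u₁ j, integral_momentTerm_le u₀ u₁ hν0 hj h₁⟩
    ⟨integrable_momentTerm u₂ u₁ j, integral_momentTerm_le u₂ u₁ hν0 hj h₃⟩
  have ic := mix
    (F := fun u x ↦ chiTerm (gaussianDensity ν u₁ x) (gaussianDensity ν u₂ x)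
      (gaussianDensity ν u x))
    ⟨integrable_chiTerm u₀ u₁ u₂, integral_chiTerm_le u₀ u₁ u₂ hν h₁ h₂ h₃⟩
    ⟨integrable_chiTerm u₂ u₁ u₂, integral_chiTerm_le u₂ u₁ u₂ hν h₃ (by simp) h₃⟩
  have total := ((mix (ig u₀) (ig u₂)).add il).add ((((ic.const_mul (sq_nonneg τ)).add
    (((im (show (1 : ℝ) ≤ 3 by norm_num)).const_mul (pow_nonneg h0.le 3)).const_mul hL)).add
    (((im hα.le).const_mul (Real.rpow_nonneg h0.le α)).const_mul hR)).const_mul hK)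
  refine ⟨_, total.mono ?_, fun x ↦ mixture_rpow_le hα H (gaussianDensity_pos ..)
    (gaussianDensity_pos ..) (gaussianDensity_pos ..) h0 h1⟩
  -- Every remainder term carries a factor `τ²`.
  have hτα : τ ^ α = τ ^ 2 * τ ^ (α - 2) := by
    rw [← Real.rpow_natCast, ← Real.rpow_add h0]; congr 1; norm_num
  rw [hτα, show (3 : ℝ) * (3 - 1) * (1 / ν ^ 2) / 2 = 3 * (1 / ν ^ 2) by ring]
  have := mul_le_mul_of_nonneg_left hKLR (sq_nonneg τ)
  refine (le_of_eq ?_).trans ((add_le_add_right this 1).trans_eq ?_) <;> ring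

end Integrals

/-! ### Rényi divergence of measures with densities -/

/-- Positivity of `q` gives absolute continuity with derivative `p / q`, and `(p / q) ^ α q = p ^ α
q ^ (1 - α)`. -/
lemma renyiDiv_withDensity_le {E : Type*} [MeasurableSpace E] {γ : Measure E} {p q B : E → ℝ}
    {α ρ : ℝ} (hα : 1 < α) (hp : Measurable p) (hq : Measurable q) (hp0 : ∀ x, 0 ≤ p x)
    (hq0 : ∀ x, 0 < q x) (hqi : Integrable q γ)
    (hB : IntegralLE γ B (Real.exp ((α - 1) * ρ)))
    (hle : ∀ x, p x ^ α * q x ^ (1 - α) ≤ B x) :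
    renyiDiv α (γ.withDensity fun x ↦ ENNReal.ofReal (p x))
      (γ.withDensity fun x ↦ ENNReal.ofReal (q x)) ≤ ρ := by
  set Q := γ.withDensity fun x ↦ ENNReal.ofReal (q x) with hQ
  have : IsFiniteMeasure Q := isFiniteMeasure_withDensity_ofReal hqi.2
  have hP : (γ.withDensity fun x ↦ ENNReal.ofReal (p x)) =
      Q.withDensity fun x ↦ ENNReal.ofReal (p x / q x) := by
    rw [hQ, ← withDensity_mul _ (by fun_prop) (by fun_prop)]
    congr 1 with x
    rw [Pi.mul_apply, ← ENNReal.ofReal_mul (hq0 x).le, mul_div_cancel₀ _ (hq0 x).ne']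
  rw [hP, renyiDiv, if_pos (withDensity_absolutelyContinuous _ _)]
  have hlint : ∫⁻ x, ((Q.withDensity fun x ↦ ENNReal.ofReal (p x / q x)).rnDeriv Q x) ^ α ∂Q ≤
      ENNReal.ofReal (Real.exp ((α - 1) * ρ)) := by
    calc _ = ∫⁻ x, ENNReal.ofReal (p x / q x) ^ α ∂Q := by
          refine lintegral_congr_ae ?_
          filter_upwards [Measure.rnDeriv_withDensity Q
            (f := fun x ↦ ENNReal.ofReal (p x / q x)) (by fun_prop)] with x hx
          rw [hx]
      _ = ∫⁻ x, ENNReal.ofReal (p x ^ α * q x ^ (1 - α)) ∂γ := by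
          rw [hQ, lintegral_withDensity_eq_lintegral_mul _ (by fun_prop) (by fun_prop)]
          refine lintegral_congr fun x ↦ ?_
          rw [Pi.mul_apply, ENNReal.ofReal_rpow_of_nonneg (div_nonneg (hp0 x) (hq0 x).le)
            (by linarith), ← ENNReal.ofReal_mul (hq0 x).le]
          congr 1
          rw [Real.div_rpow (hp0 x) (hq0 x).le, Real.rpow_sub (hq0 x), Real.rpow_one]
          ring
      _ ≤ ∫⁻ x, ENNReal.ofReal (B x) ∂γ :=
          lintegral_mono fun x ↦ ENNReal.ofReal_le_ofReal (hle x)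
      _ = ENNReal.ofReal (∫ x, B x ∂γ) := by
          refine (ofReal_integral_eq_lintegral_ofReal hB.1 (ae_of_all _ fun x ↦ ?_)).symm
          exact le_trans (mul_nonneg (Real.rpow_nonneg (hp0 x) _)
            (Real.rpow_nonneg (hq0 x).le _)) (hle x)
      _ ≤ _ := ENNReal.ofReal_le_ofReal hB.2
  calc (((α - 1)⁻¹ : ℝ) : EReal) * ENNReal.log _
      ≤ (((α - 1)⁻¹ : ℝ) : EReal) * ENNReal.log (ENNReal.ofReal (Real.exp ((α - 1) * ρ))) := by
        refine mul_le_mul_of_nonneg_left (ENNReal.log_le_log hlint) ?_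
        exact_mod_cast inv_nonneg.2 (by linarith)
    _ = ρ := by
        rw [ENNReal.log_ofReal_of_pos (Real.exp_pos _), Real.log_exp, ← EReal.coe_mul,
          inv_mul_cancel_left₀ (by linarith)]

/-! ### Coupling of the subsamples of adjacent datasets -/

/-- The pairs `(c, T)` of a subcollection `T` of size `k` and a further entry `c`. -/
def pointedSubsets {X : Type*} [DecidableEq X] (k : ℕ) (C : Multiset X) :
    Multiset (X × Multiset X) :=
  (C.powersetCard k).bind fun T ↦ (C - T).map fun c ↦ (c, T)

lemma sum_pointedSubsets {X A : Type*} [DecidableEq X] [AddCommMonoid A] (k : ℕ)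
    (C : Multiset X) (F : X × Multiset X → A) :
    ((pointedSubsets k C).map F).sum =
      ((C.powersetCard k).map fun T ↦ ((C - T).map fun c ↦ F (c, T)).sum).sum := by
  simp [pointedSubsets, Multiset.map_bind, Multiset.sum_bind, Multiset.map_map]

/-- Each subset of size `k + 1` arises once for every choice of which of its entries is the point.
The induction on `C` follows Pascal's rule. -/
lemma sum_pointedSubsets_cons {X A : Type*} [DecidableEq X] [AddCommMonoid A]
    (C : Multiset X) (k : ℕ) (F : Multiset X → A) :
    ((pointedSubsets k C).map fun w ↦ F (w.1 ::ₘ w.2)).sum =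
      (k + 1) • ((C.powersetCard (k + 1)).map F).sum := by
  rw [sum_pointedSubsets]
  induction C using Multiset.induction generalizing k F with
  | empty => cases k <;> simp [Multiset.powersetCard_zero_right]
  | cons x C ih =>
    cases k with
    | zero => simp [Multiset.powersetCard_one, Multiset.map_map, add_comm]
    | succ k =>
      have h1 : ((C.powersetCard (k + 1)).map fun T ↦
          (((x ::ₘ C) - T).map fun c ↦ F (c ::ₘ T)).sum) =
          (C.powersetCard (k + 1)).map fun T ↦
            F (x ::ₘ T) + ((C - T).map fun c ↦ F (c ::ₘ T)).sum := by
        refine Multiset.map_congr rfl fun T hT ↦ ?_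
        rw [Multiset.cons_sub_of_le _ (Multiset.mem_powersetCard.1 hT).1]
        simp
      have h2 := ih k fun T ↦ F (x ::ₘ T)
      simp only [Multiset.cons_swap x] at h2
      rw [Multiset.powersetCard_cons, Multiset.powersetCard_cons]
      simp only [Multiset.map_add, Multiset.sum_add, Multiset.map_map, Function.comp_def]
      rw [h1, Multiset.sum_map_add, ih]
      simp only [Multiset.sub_cons, Multiset.erase_cons_head]
      rw [h2]
      module

lemma sum_pointedSubsets_snd {X A : Type*} [DecidableEq X] [AddCommMonoid A]
    (C : Multiset X) (k : ℕ) (F : Multiset X → A) :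
    ((pointedSubsets k C).map fun w ↦ F w.2).sum =
      (C.card - k) • ((C.powersetCard k).map F).sum := by
  rw [sum_pointedSubsets, ← Multiset.sum_map_nsmul]
  congr 1
  refine Multiset.map_congr rfl fun T hT ↦ ?_
  obtain ⟨hle, hc⟩ := Multiset.mem_powersetCard.1 hT
  simp [Multiset.card_sub hle, hc]

lemma card_pointedSubsets {X : Type*} [DecidableEq X] (C : Multiset X) (k : ℕ) :
    (pointedSubsets k C).card = (C.card - k) * C.card.choose k := by
  have := sum_pointedSubsets_snd C k fun _ ↦ 1
  simpa using this

/-- The average of `φ` over the subsamples of `a ::ₘ C` as an average over pointed subsets. -/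
lemma average_powersetCard_cons {X : Type*} [DecidableEq X] {C : Multiset X} {N k : ℕ} {τ : ℝ}
    (hC : C.card + 1 = N) (hk : k + 1 < N) (hτ : ((k + 1 : ℕ) : ℝ) = τ * N) (a : X)
    (φ : Multiset X → ℝ) :
    (N.choose (k + 1) : ℝ)⁻¹ * (((a ::ₘ C).powersetCard (k + 1)).map φ).sum =
      ((pointedSubsets k C).card : ℝ)⁻¹ *
        ((pointedSubsets k C).map fun w ↦
          (1 - τ) * φ (w.1 ::ₘ w.2) + τ * φ (a ::ₘ w.2)).sum := by
  rw [Multiset.sum_map_add, Multiset.sum_map_mul_left, Multiset.sum_map_mul_left,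
    sum_pointedSubsets_cons, sum_pointedSubsets_snd C k fun T ↦ φ (a ::ₘ T),
    card_pointedSubsets, Multiset.powersetCard_cons]
  -- For sample size `k + 1`, `j + 1` is the number of entries left out, so `τ = (k + 1) / N` and `1
  -- - τ = (j + 1) / N`.
  obtain ⟨j, hj⟩ : ∃ j, C.card = k + (j + 1) := ⟨C.card - k - 1, by omega⟩
  have hch : 0 < C.card.choose k := Nat.choose_pos (by omega)
  have hmul := Nat.add_one_mul_choose_eq C.card k
  rw [hC] at hmul
  have hN : 0 < N.choose (k + 1) := Nat.choose_pos (by omega)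
  rw [show C.card - k = j + 1 by omega]
  simp only [Multiset.map_add, Multiset.sum_add, Multiset.map_map, Function.comp_def,
    nsmul_eq_mul]
  have hNj : (N : ℝ) = k + 1 + (j + 1) := by
    have : N = k + 1 + (j + 1) := by omega
    rw [this]; push_cast; ring
  have hN0 : (N : ℝ) ≠ 0 := by rw [hNj]; positivity
  have hτ' : τ = (k + 1) / N := by rw [eq_div_iff hN0, ← hτ]; push_cast; ring
  have hτ1 : 1 - τ = (j + 1) / N := by rw [hτ', hNj]; field_simp; ring
  have hmulR : (N : ℝ) * C.card.choose k = N.choose (k + 1) * (k + 1) := by exact_mod_cast hmul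
  have hch' : (C.card.choose k : ℝ) = N.choose (k + 1) * (k + 1) / N := by
    rw [eq_div_iff hN0, ← hmulR, mul_comm]
  have : (N.choose (k + 1) : ℝ) ≠ 0 := by positivity
  rw [hτ1, hτ']
  push_cast
  rw [hch']
  field_simp

lemma adjacent_mk {X : Type*} {n : ℕ} {T : Multiset X} (a b : X) (ha : (a ::ₘ T).card = n)
    (hb : (b ::ₘ T).card = n) : Adjacent (Sym.mk (a ::ₘ T) ha) (Sym.mk (b ::ₘ T) hb) :=
  ⟨T, a, b, rfl, rfl⟩

/-- The uniform subsamples of two adjacent datasets are coupled so that, with probability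
`1 - τ`, they agree, and the remaining alternatives are pairwise adjacent. -/
lemma exists_coupling {X : Type*} {N m : ℕ} (hm : 1 ≤ m) (hmN : m < N) {τ : ℝ}
    (hτ : (m : ℝ) = τ * N) {D D' : Dataset X N} (h : Adjacent D D') :
    ∃ W : Multiset (Dataset X m × Dataset X m × Dataset X m), 0 < W.card ∧
      (∀ w ∈ W, Adjacent w.2.1 w.1 ∧ Adjacent w.2.2 w.1 ∧ Adjacent w.2.1 w.2.2) ∧
      ∀ φ : Dataset X m → ℝ,
        (N.choose m : ℝ)⁻¹ * ((subsets m D).map φ).sum =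
          (W.card : ℝ)⁻¹ * (W.map fun w ↦ (1 - τ) * φ w.1 + τ * φ w.2.1).sum ∧
        (N.choose m : ℝ)⁻¹ * ((subsets m D').map φ).sum =
          (W.card : ℝ)⁻¹ * (W.map fun w ↦ (1 - τ) * φ w.1 + τ * φ w.2.2).sum := by
  classical
  obtain ⟨C, a, b, hD, hD'⟩ := h
  obtain ⟨k, rfl⟩ : ∃ k, m = k + 1 := ⟨m - 1, by omega⟩
  have hC : C.card + 1 = N := by
    have := congrArg Multiset.card hD
    rw [Multiset.card_cons] at this
    rw [← this]; exact D.2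
  -- A total version of `Sym.mk`, so that sums over subsets become plain maps; the default value is
  -- never met.
  let mk : Multiset X → Dataset X (k + 1) := fun s ↦
    if hs : s.card = k + 1 then Sym.mk s hs else Sym.replicate (k + 1) a
  have hmk {s : Multiset X} (hs : s.card = k + 1) : mk s = Sym.mk s hs := dif_pos hs
  have hsub (D : Dataset X N) : subsets (k + 1) D =
      ((D : Multiset X).powersetCard (k + 1)).map mk := by
    rw [subsets, ← Multiset.pmap_eq_map (fun s ↦ s.card = k + 1) mk _
      (fun _ hs ↦ (Multiset.mem_powersetCard.mp hs).2)]
    exact Multiset.pmap_congr _ fun s _ hs _ ↦ (hmk hs).symm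
  refine ⟨(pointedSubsets k C).map fun w ↦ (mk (w.1 ::ₘ w.2), mk (a ::ₘ w.2), mk (b ::ₘ w.2)),
    ?_, ?_, fun φ ↦ ?_⟩
  · rw [Multiset.card_map, card_pointedSubsets]
    exact Nat.mul_pos (by omega) (Nat.choose_pos (by omega))
  · intro w hw
    obtain ⟨⟨c, T⟩, hv, rfl⟩ := Multiset.mem_map.1 hw
    obtain ⟨T', hT', hv'⟩ := Multiset.mem_bind.1 hv
    obtain ⟨c', -, he⟩ := Multiset.mem_map.1 hv'
    obtain ⟨rfl, rfl⟩ := Prod.mk.inj he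
    have hT := (Multiset.mem_powersetCard.1 hT').2
    have hcard (x : X) : (x ::ₘ T').card = k + 1 := by simp [hT]
    simp only [hmk (hcard _)]
    exact ⟨adjacent_mk _ _ _ _, adjacent_mk _ _ _ _, adjacent_mk _ _ _ _⟩
  · rw [hsub, hsub, hD, hD']
    simp only [Multiset.map_map, Function.comp_def, Multiset.card_map]
    exact ⟨average_powersetCard_cons hC hmN hτ a fun s ↦ φ (mk s),
      average_powersetCard_cons hC hmN hτ b fun s ↦ φ (mk s)⟩

/-! ### The subsampled Gaussian mechanism -/

lemma multiset_sum_isoGaussian {ι : Type*} {d : ℕ} {ν : ℝ} (hν : ν ≠ 0) (V : Multiset ι)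
    (u : ι → EuclideanSpace ℝ (Fin d)) :
    (V.map fun i ↦ isoGaussian ν (u i)).sum = (isoGaussian ν 0).withDensity
      fun x ↦ ENNReal.ofReal (V.map fun i ↦ gaussianDensity ν (u i) x).sum := by
  induction V using Multiset.induction with
  | empty => simp
  | cons i V ih =>
    simp only [Multiset.map_cons, Multiset.sum_cons]
    rw [ih, isoGaussian_eq_withDensity hν, ← withDensity_add_left (by fun_prop)]
    congr 1 with x
    rw [Pi.add_apply, ENNReal.ofReal_add (gaussianDensity_pos ..).le]
    exact Multiset.sum_nonneg (by simpa using fun i _ ↦ (gaussianDensity_pos ν (u i) x).le)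

@[fun_prop]
lemma measurable_multiset_sum_map {ι E : Type*} [MeasurableSpace E] (V : Multiset ι)
    {F : ι → E → ℝ} (hF : ∀ i, Measurable (F i)) :
    Measurable fun x ↦ (V.map fun i ↦ F i x).sum := by
  induction V using Multiset.induction with
  | empty => simp
  | cons i V ih =>
    simp only [Multiset.map_cons, Multiset.sum_cons]
    exact (hF i).add ih

lemma uniformSubsampled_eq_withDensity {X : Type*} {N m d : ℕ} (hmN : m ≤ N) {ν : ℝ} (hν : ν ≠ 0)
    (f : Dataset X m → EuclideanSpace ℝ (Fin d)) (D : Dataset X N) :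
    uniformSubsampled N (gaussianMechanism f ν) D = (isoGaussian ν 0).withDensity fun x ↦
      ENNReal.ofReal ((N.choose m : ℝ)⁻¹ *
        ((subsets m D).map fun S ↦ gaussianDensity ν (f S) x).sum) := by
  have hc : 0 < N.choose m := Nat.choose_pos hmN
  rw [uniformSubsampled]
  change _ • ((subsets m D).map fun S ↦ isoGaussian ν (f S)).sum = _
  rw [multiset_sum_isoGaussian hν, ← withDensity_smul _
    (measurable_multiset_sum_map _ fun S ↦ measurable_gaussianDensity ν (f S)).ennreal_ofReal]
  congr 1 with x
  rw [Pi.smul_apply, smul_eq_mul, ENNReal.ofReal_mul (by positivity),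
    ENNReal.ofReal_inv_of_pos (by positivity), ENNReal.ofReal_natCast]

lemma norm_sub_le_of_adjacent {X : Type*} {m d : ℕ} {f : Dataset X m → EuclideanSpace ℝ (Fin d)}
    (hf : l2Sensitivity f ≤ 1) {S S' : Dataset X m} (h : Adjacent S S') : ‖f S - f S'‖ ≤ 1 := by
  have h1 : edist (f S) (f S') ≤ 1 :=
    le_trans (le_iSup_of_le S (le_iSup_of_le S' (le_iSup (fun _ : Adjacent S S' ↦ edist (f S) (f S')) h))) hf
  rwa [edist_dist, ENNReal.ofReal_le_one, dist_eq_norm] at h1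

/-- Rényi divergences of averages of densities, bounded by the summands. -/
lemma renyiDiv_average_le {ι E : Type*} [MeasurableSpace E] {γ : Measure E} {W : Multiset ι}
    (hW : 0 < W.card) {p q : ι → E → ℝ} {α ρ : ℝ} (hα : 1 < α) (hpm : ∀ i, Measurable (p i))
    (hqm : ∀ i, Measurable (q i)) (hp : ∀ i x, 0 < p i x) (hq : ∀ i x, 0 < q i x) {c : ℝ}
    (hqi : ∀ i, IntegralLE γ (q i) c)
    (h : ∀ i ∈ W, ∃ B, IntegralLE γ B (Real.exp ((α - 1) * ρ)) ∧
      ∀ x, p i x ^ α * q i x ^ (1 - α) ≤ B x) :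
    renyiDiv α
      (γ.withDensity fun x ↦ ENNReal.ofReal ((W.card : ℝ)⁻¹ * (W.map fun i ↦ p i x).sum))
      (γ.withDensity fun x ↦ ENNReal.ofReal ((W.card : ℝ)⁻¹ * (W.map fun i ↦ q i x).sum)) ≤
        ρ := by
  choose! B hB hle using h
  have hW' : (0 : ℝ) < W.card := by exact_mod_cast hW
  have hc : 0 < (W.card : ℝ)⁻¹ := inv_pos.2 hW'
  have hP (x) : 0 < (W.map fun i ↦ p i x).sum := multiset_sum_map_pos (fun i ↦ hp i x) hW
  have hQ (x) : 0 < (W.map fun i ↦ q i x).sum := multiset_sum_map_pos (fun i ↦ hq i x) hW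
  refine renyiDiv_withDensity_le (B := fun x ↦ (W.card : ℝ)⁻¹ * (W.map fun i ↦ B i x).sum) hα
    ((measurable_multiset_sum_map W hpm).const_mul _)
    ((measurable_multiset_sum_map W hqm).const_mul _) (fun x ↦ (mul_pos hc (hP x)).le)
    (fun x ↦ mul_pos hc (hQ x))
    ((IntegralLE.multiset_sum W fun i _ ↦ hqi i).1.const_mul _) ?_ (fun x ↦ ?_)
  · refine ((IntegralLE.multiset_sum W hB).const_mul hc.le).mono ?_
    rw [inv_mul_cancel_left₀ hW'.ne']
  -- By homogeneity of degree 1 the normalizing constant factors out.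
  · rw [Real.mul_rpow hc.le (hP x).le, Real.mul_rpow hc.le (hQ x).le, mul_mul_mul_comm,
      ← Real.rpow_add hc, add_sub_cancel, Real.rpow_one]
    refine mul_le_mul_of_nonneg_left ?_ hc.le
    refine (multiset_sum_rpow_le hα (fun i ↦ (hp i x).le) (fun i ↦ hq i x) W).trans ?_
    exact Multiset.sum_map_le_sum_map _ _ fun i hi ↦ hle i hi x

lemma isRDP_uniformSubsampled_gaussianMechanism {X : Type*} {N m d : ℕ} (hm : 1 ≤ m)
    (hmN : m < N) {τ : ℝ} (hτ : (m : ℝ) = τ * N) (f : Dataset X m → EuclideanSpace ℝ (Fin d))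
    (hf : l2Sensitivity f ≤ 1) {ν : ℝ} (hν : 2 / 3 ≤ ν ^ 2) {α : ℝ} (hα : 1 < α)
    (h0 : 0 < τ) (h1 : τ < 1)
    (h : α * τ * (1 + ν ^ 2) ≤ Real.exp (-(3 / 2 * (α - 1) * (1 / ν ^ 2)))) :
    IsRDP α (3.5 * τ ^ 2 * α / ν ^ 2) (uniformSubsampled N (gaussianMechanism f ν)) := by
  intro D D' hDD'
  have hν0 : ν ≠ 0 := by rintro rfl; norm_num at hν
  have hτ0 : 0 < 1 - τ := by linarith
  obtain ⟨W, hW, hadj, hφ⟩ := exists_coupling hm hmN hτ hDD'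
  rw [uniformSubsampled_eq_withDensity hmN.le hν0, uniformSubsampled_eq_withDensity hmN.le hν0]
  simp only [(hφ _).1, (hφ _).2]
  have hpos (u v x : EuclideanSpace ℝ (Fin d)) :
      0 < (1 - τ) * gaussianDensity ν u x + τ * gaussianDensity ν v x :=
    add_pos (mul_pos hτ0 (gaussianDensity_pos ..)) (mul_pos h0 (gaussianDensity_pos ..))
  have hmeas (u v : EuclideanSpace ℝ (Fin d)) :
      Measurable fun x ↦ (1 - τ) * gaussianDensity ν u x + τ * gaussianDensity ν v x := by
    fun_prop
  have hgi (u : EuclideanSpace ℝ (Fin d)) :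
      IntegralLE (isoGaussian ν 0) (gaussianDensity ν u) 1 :=
    ⟨integrable_gaussianDensity _, (integral_gaussianDensity _ hν0).le⟩
  refine renyiDiv_average_le hW hα (fun w ↦ hmeas (f w.1) (f w.2.1))
    (fun w ↦ hmeas (f w.1) (f w.2.2)) (fun w ↦ hpos (f w.1) (f w.2.1))
    (fun w ↦ hpos (f w.1) (f w.2.2))
    (fun w ↦ ((hgi (f w.1)).const_mul hτ0.le).add ((hgi (f w.2.2)).const_mul h0.le))
    fun w hw ↦ ?_
  obtain ⟨B, hB, hle⟩ := exists_integrable_bound (f w.1) (f w.2.1) (f w.2.2) hν hα h0 h1 h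
    (norm_sub_le_of_adjacent hf (hadj w hw).1) (norm_sub_le_of_adjacent hf (hadj w hw).2.1)
    (norm_sub_le_of_adjacent hf (hadj w hw).2.2)
  refine ⟨B, hB.mono ?_, hle⟩
  refine le_trans (le_of_eq ?_) (Real.add_one_le_exp _)
  ring

end SubsampledRDP

theorem mainTheorem5 {X : Type*} (N m d : ℕ) (hm : 1 ≤ m) (hmN : m ≤ N)
    (τ : ℝ) (hτ : (m : ℝ) = τ * (N : ℝ))
    (f : SubsampledRDP.Dataset X m → EuclideanSpace ℝ (Fin d))
    (hf : SubsampledRDP.l2Sensitivity f ≤ 1)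
    (ν : ℝ) (hν : 2 / 3 ≤ ν ^ 2)
    (α : ℝ) (hα : 1 < α)
    (hα' : α - 1 ≤ 2 / 3 * ν ^ 2 * Real.log (1 / (α * τ * (1 + ν ^ 2)))) :
    SubsampledRDP.IsRDP α (3.5 * τ ^ 2 * α / ν ^ 2)
      (SubsampledRDP.uniformSubsampled N (SubsampledRDP.gaussianMechanism f ν)) := by
  have hm0 : (0 : ℝ) < m := by exact_mod_cast hm
  have hN0 : (0 : ℝ) < N := by exact_mod_cast hm.trans hmN
  have h0 : 0 < τ := pos_of_mul_pos_left (hτ ▸ hm0) hN0.le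
  have hν0 : 0 < ν ^ 2 := by linarith
  have hα0 : 0 < α := by linarith
  have hy : 0 < α * τ * (1 + ν ^ 2) := by positivity
  have h : α * τ * (1 + ν ^ 2) ≤ Real.exp (-(3 / 2 * (α - 1) * (1 / ν ^ 2))) := by
    rw [← Real.log_le_iff_le_exp hy]
    rw [one_div, Real.log_inv] at hα'
    have : 3 / 2 * (α - 1) * (1 / ν ^ 2) ≤ -Real.log (α * τ * (1 + ν ^ 2)) := by
      rw [mul_one_div, div_le_iff₀ hν0]
      linarith
    linarith
  -- The hypothesis forces `α τ (1 + ν²) ≤ 1`, which excludes `m = N`.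
  have h1 : τ < 1 := by
    have h2 : Real.exp (-(3 / 2 * (α - 1) * (1 / ν ^ 2))) ≤ 1 := by
      refine Real.exp_le_one_iff.2 (neg_nonpos.2 ?_)
      have : 0 ≤ α - 1 := by linarith
      positivity
    nlinarith [mul_pos (mul_pos hα0 h0) hν0]
  have hlt : m < N := by
    have : (m : ℝ) < N := by rw [hτ]; nlinarith
    exact_mod_cast this
  exact SubsampledRDP.isRDP_uniformSubsampled_gaussianMechanism hm hlt hτ f hf hν hα h0 h1 h
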